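/- For $\lambda\ge 1$, write points of the frequency plane $\mathbb R^2$ as $(\xi,\tau)$, put $\langle x\rangle=(1+x^2)^{1/2}$, and for integers $j,k\ge 0$ let $$A_j=\{(\xi,\tau): 2^j\le\langle\xi\rangle<2^{j+1}\},\qquad B_k=\Bigl\{(\xi,\tau): 2^k\le\Bigl\langle\tau+\xi^3+\frac1{\lambda^4\xi}\Bigr\rangle<2^{k+1}\Bigr\}.$$ For $f\in\mathscr S'(\mathbb R^2)$ let $$\|f\|_{\hat X^{s,b,1}}=\Bigl[\sum_{j\ge0}\Bigl(\sum_{k\ge0}\Bigl\|\langle\xi\rangle^s\Bigl\langle\tau+\xi^3+\frac1{\lambda^4\xi}\Bigr\rangle^b f\Bigr\|_{L^2_{\xi\tau}(A_j\cap B_k)}\Bigr)^2\Bigr]^{1/2}\in[0,\infty],$$ with value $\infty$ if $f$ is not a locally integrable function. There is a constant $C>0$ such that the following holds for all $\lambda\ge1$, all integers $j_1,j_2\ge0$ and all $f,g\in\mathscr S'(\mathbb R^2)$ that are given by locally integrable functions and satisfy $\operatorname{supp} f\subset A_{j_1}$, $\operatorname{supp} g\subset A_{j_2}$. Suppose that for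 all $(\xi_1,\tau_1)\in\operatorname{supp} f$ and $(\xi_2,\tau_2)\in\operatorname{supp} g$, with $\xi=\xi_1+\xi_2$, either $$\xi_1\xi_2>0\qquad\text{or}\qquad \xi_1\xi_2\le0\ \text{ and }\ \Bigl|1+\frac{4}{3\lambda^4\xi^2\xi_1\xi_2}\Bigr|>\frac12,$$ where the last inequality is regarded as satisfied if $\xi\xi_1\xi_2=0$. Let $$K=\inf\bigl\{|\xi_1-\xi_2| : \exists\,\tau_1,\tau_2 \text{ with } (\xi_1,\tau_1)\in\operatorname{supp} f,\ (\xi_2,\tau_2)\in\operatorname{supp} g\bigr\},$$ with $K=\infty$ if one of the supports is empty. Then, if both $\hat X^{0,1/2,1}$ norms are finite, the integral defining $f*g$ converges absolutely at every point, and in general $$\bigl\||\xi|^{1/4}f*g\bigr\|_{L^2(\mathbb R^2)}\le C\,\|f\|_{\hat X^{0,1/2,1}}\|g\|_{\hat X^{0,1/2,1}},$$ $$\bigl\||\xi|^{1/2}f*g\bigr\|_{L^2(\mathbb R^2)}\le C\,K^{-1/2}\,\|f\|_{\hat X^{0,1/2,1}}\|g\|_{\hat X^{0,1/2,1}}.$$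 Here, in $[0,\infty]$, $0^{-1/2}=\infty$, $\infty^{-1/2}=0$ and $0\cdot\infty=0$; the inequalities carry no information when their right-hand sides are infinite. -/

import Mathlib

open scoped ENNReal NNReal SchwartzMap
open MeasureTheory

noncomputable section

namespace Ostrovsky

/-! Points of the frequency plane `ℝ × ℝ` are written `p = (ξ, τ)`, so `p.1 = ξ`, `p.2 = τ`. -/

/-- The Japanese bracket `⟨x⟩ = (1 + x²)^{1/2}`. -/
def bracket (x : ℝ) : ℝ := Real.sqrt (1 + x ^ 2)

/-- The modulation `τ + ξ³ + 1/(lam⁴ ξ)`. (The null line `ξ = 0` plays no role.) -/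
def modulation (lam : ℝ) (p : ℝ × ℝ) : ℝ := p.2 + p.1 ^ 3 + 1 / (lam ^ 4 * p.1)

/-- The dyadic frequency annulus `A_j = {2^j ≤ ⟨ξ⟩ < 2^{j+1}}`. -/
def A (j : ℕ) : Set (ℝ × ℝ) := {p | 2 ^ j ≤ bracket p.1 ∧ bracket p.1 < 2 ^ (j + 1)}

/-- The dyadic modulation region `B_k = {2^k ≤ ⟨τ + ξ³ + 1/(lam⁴ ξ)⟩ < 2^{k+1}}`. -/
def B (lam : ℝ) (k : ℕ) : Set (ℝ × ℝ) :=
  {p | 2 ^ k ≤ bracket (modulation lam p) ∧ bracket (modulation lam p) < 2 ^ (k + 1)}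

/-- The norm `‖ ( ‖⟨ξ⟩^s ⟨τ + ξ³ + 1/(lam⁴ ξ)⟩^b F‖_{L²(A_j ∩ B_k)} )_{j,k} ‖_{ℓ²_j(ℓ¹_k)}`
of a function `F` on the frequency plane. -/
def hatNormFun (lam s b : ℝ) (F : ℝ × ℝ → ℂ) : ℝ≥0∞ :=
  (∑' j : ℕ, (∑' k : ℕ,
    eLpNorm (fun p => ((bracket p.1 ^ s * bracket (modulation lam p) ^ b : ℝ) : ℂ) * F p) 2
      (volume.restrict (A j ∩ B lam k))) ^ (2 : ℝ)) ^ (1 / 2 : ℝ)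

/-- The tempered distribution `f` is (given by integration against) the locally integrable
function `F`. Such an `F` is unique up to null sets. -/
def IsGivenBy (f : 𝓢'(ℝ × ℝ, ℂ)) (F : ℝ × ℝ → ℂ) : Prop :=
  LocallyIntegrable F volume ∧
    ∀ φ : 𝓢(ℝ × ℝ, ℂ), HasCompactSupport φ → f φ = ∫ p, φ p * F p

/-- The norm of `X̂^{s,b,1}`. Since `‖u‖_{X^{s,b,1}}` is by definition a weighted norm of the
Fourier transform of `u`, the norm `‖f‖ = ‖𝓕⁻¹ f‖_{X^{s,b,1}}` is that weighted norm of `f` itself.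
It is `∞` when `f` is not a function. -/
def hatNorm (lam s b : ℝ) (f : 𝓢'(ℝ × ℝ, ℂ)) : ℝ≥0∞ :=
  ⨅ (F : ℝ × ℝ → ℂ) (_ : IsGivenBy f F), hatNormFun lam s b F

/-- `K`, the infimum of `|ξ₁ - ξ₂|` over `(ξ₁, τ₁) ∈ supp f`, `(ξ₂, τ₂) ∈ supp g`
(`∞` when a support is empty). -/
def freqSep (f g : 𝓢'(ℝ × ℝ, ℂ)) : ℝ≥0∞ :=
  ⨅ p₁ ∈ Distribution.dsupport f, ⨅ p₂ ∈ Distribution.dsupport g, ENNReal.ofReal |p₁.1 - p₂.1|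

/-- Either `ξ₁ ξ₂ > 0`, or `ξ₁ ξ₂ ≤ 0` and `|1 + 4 / (3 lam⁴ ξ² ξ₁ ξ₂)| > 1/2` with `ξ = ξ₁ + ξ₂`.
When `ξ ξ₁ ξ₂ = 0` the fraction is undefined (its modulus tends to `∞`); such pairs count as
admissible, which is what division by zero gives here. -/
def Admissible (lam ξ₁ ξ₂ : ℝ) : Prop :=
  0 < ξ₁ * ξ₂ ∨
    (ξ₁ * ξ₂ ≤ 0 ∧ 1 / 2 < |1 + 4 / (3 * lam ^ 4 * (ξ₁ + ξ₂) ^ 2 * (ξ₁ * ξ₂))|)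

/-- The convolution `F * G` on the frequency plane. -/
def conv (F G : ℝ × ℝ → ℂ) : ℝ × ℝ → ℂ :=
  convolution F G (ContinuousLinearMap.mul ℂ ℂ) volume

/-- `‖ |ξ|^a H ‖_{L²(ℝ²)}`. -/
def weightedL2 (a : ℝ) (H : ℝ × ℝ → ℂ) : ℝ≥0∞ :=
  eLpNorm (fun p => ((|p.1| ^ a : ℝ) : ℂ) * H p) 2 volume

end Ostrovsky

end

noncomputable section

namespace Ostrovsky

/-! Split both factors by modulation into dyadic pieces `B lam k`, `B lam l`. By Cauchy–Schwarz in
the convolution integral, each pair of pieces costs the square root of the measure of the pairs `(t,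
p - t)` that interact to give `p = (ξ, τ)`. For fixed first frequency `x`, the time frequency runs
over a set of diameter `O(2 ^ min k l)`. The modulations of `t` and `p - t` add up to `τ +
phaseSum`, so `x` itself is confined to a set where this sum is `O(2 ^ max k l)`.

That set is measured by comparing two of its points, without derivatives: `phaseSum_sub` factors the
phase difference, and its last factor is at least 3 when `x(ξ - x)` and `y(ξ - y)` have the same
sign. Hence `|x - y| |x + y - ξ| ≲ 2 ^ max k l / |ξ|`. If `x` and `y` also lie on the same side of
`ξ / 2`, the second factor dominates both `|x - y|` and `K`, which gives the two estimates. The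
resulting weights `2 ^ (k / 2)`, `2 ^ (l / 2)` are those of the norm, and Minkowski's inequality
sums the pieces. -/

/-! ### Resonant frequencies on the line -/

/-- The value of the sum of the phases at `x` and `ξ - x`. -/
def phaseSum (L ξ x : ℝ) : ℝ := x ^ 3 + 1 / (L * x) + ((ξ - x) ^ 3 + 1 / (L * (ξ - x)))

/-- The phase sum depends on `x` only through `P = x(ξ - x)`: it equals `ξ³ - 3ξP + ξ/(LP)`. -/
lemma phaseSum_sub {L ξ x y : ℝ} (hL : L ≠ 0) (hx : x * (ξ - x) ≠ 0) (hy : y * (ξ - y) ≠ 0) :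
    phaseSum L ξ x - phaseSum L ξ y =
      ξ * ((x - y) * (x + y - ξ)) * (3 + 1 / (L * ((x * (ξ - x)) * (y * (ξ - y))))) := by
  have h1 : x ≠ 0 := left_ne_zero_of_mul hx
  have h2 : ξ - x ≠ 0 := right_ne_zero_of_mul hx
  have h3 : y ≠ 0 := left_ne_zero_of_mul hy
  have h4 : ξ - y ≠ 0 := right_ne_zero_of_mul hy
  unfold phaseSum
  field_simp
  ring

lemma abs_mul_abs_le_of_phaseSum {L ξ x y τ M : ℝ} (hL : 0 < L) (hξ : ξ ≠ 0)
    (hxy : 0 < (x * (ξ - x)) * (y * (ξ - y)))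
    (hx : |τ + phaseSum L ξ x| ≤ M) (hy : |τ + phaseSum L ξ y| ≤ M) :
    |x - y| * |x + y - ξ| ≤ 2 * M / (3 * |ξ|) := by
  have h := phaseSum_sub hL.ne' (left_ne_zero_of_mul hxy.ne') (right_ne_zero_of_mul hxy.ne')
  have h1 : |phaseSum L ξ x - phaseSum L ξ y| ≤ 2 * M := by
    rw [abs_le] at *; constructor <;> linarith [hx.1, hx.2, hy.1, hy.2]
  have h2 : 0 ≤ 1 / (L * ((x * (ξ - x)) * (y * (ξ - y)))) := by positivity
  rw [h, abs_mul, abs_mul, abs_mul, abs_of_pos (add_pos_of_pos_of_nonneg three_pos h2)] at h1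
  have hξ' : 0 < |ξ| := abs_pos.2 hξ
  rw [le_div_iff₀ (by positivity)]
  nlinarith [mul_nonneg (mul_nonneg hξ'.le (mul_nonneg (abs_nonneg (x - y))
    (abs_nonneg (x + y - ξ)))) h2]

/-- The frequencies of the interactions producing `(ξ, τ)` with modulations of size at most `M`
and frequency separation at least `K`. -/
def resonantSet (L ξ τ M K : ℝ) : Set ℝ :=
  {x | x ≠ 0 ∧ ξ - x ≠ 0 ∧ |τ + phaseSum L ξ x| ≤ M ∧ K ≤ |x - (ξ - x)|}

lemma volume_le_of_abs_sub_le {X : Set ℝ} {d : ℝ} (h : ∀ x ∈ X, ∀ y ∈ X, |x - y| ≤ d) :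
    volume X ≤ ENNReal.ofReal d := by
  refine (Real.volume_le_diam X).trans (Metric.ediam_le fun x hx y hy => ?_)
  rw [edist_dist, Real.dist_eq]
  exact ENNReal.ofReal_le_ofReal (h x hx y hy)

/-- The signs of `x(ξ - x)` and `2x - ξ` cut the set into four pieces, each of diameter at most `d`.
-/
lemma volume_resonantSet_le {L ξ τ M K d : ℝ} (hd : 0 ≤ d)
    (h : ∀ x ∈ resonantSet L ξ τ M K, ∀ y ∈ resonantSet L ξ τ M K,
      0 < (x * (ξ - x)) * (y * (ξ - y)) → 0 ≤ (2 * x - ξ) * (2 * y - ξ) → |x - y| ≤ d) :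
    volume (resonantSet L ξ τ M K) ≤ ENNReal.ofReal (4 * d) := by
  set X := resonantSet L ξ τ M K
  have hX : X ⊆ ((X ∩ {x | 0 < x * (ξ - x) ∧ 0 ≤ 2 * x - ξ}) ∪
      (X ∩ {x | 0 < x * (ξ - x) ∧ 2 * x - ξ ≤ 0})) ∪
      ((X ∩ {x | x * (ξ - x) < 0 ∧ 0 ≤ 2 * x - ξ}) ∪
      (X ∩ {x | x * (ξ - x) < 0 ∧ 2 * x - ξ ≤ 0})) := by
    intro x hx
    have h0 : x * (ξ - x) ≠ 0 := mul_ne_zero hx.1 hx.2.1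
    rcases h0.lt_or_gt with h1 | h1 <;> rcases le_total 0 (2 * x - ξ) with h2 | h2 
    · exact .inr (.inl ⟨hx, h1, h2⟩)
    · exact .inr (.inr ⟨hx, h1, h2⟩)
    · exact .inl (.inl ⟨hx, h1, h2⟩)
    · exact .inl (.inr ⟨hx, h1, h2⟩)
  have e : ENNReal.ofReal (4 * d) = (ENNReal.ofReal d + ENNReal.ofReal d) +
      (ENNReal.ofReal d + ENNReal.ofReal d) := by
    rw [← ENNReal.ofReal_add hd hd, ← ENNReal.ofReal_add (by linarith) (by linarith)]
    congr 1; ring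
  rw [e]
  refine (measure_mono hX).trans ((measure_union_le _ _).trans (add_le_add
    ((measure_union_le _ _).trans (add_le_add ?_ ?_))
    ((measure_union_le _ _).trans (add_le_add ?_ ?_)))) <;>
  refine volume_le_of_abs_sub_le fun x hx y hy => h x hx.1 y hy.1 ?_ ?_
  · exact mul_pos hx.2.1 hy.2.1
  · exact mul_nonneg hx.2.2 hy.2.2
  · exact mul_pos hx.2.1 hy.2.1
  · exact mul_nonneg_of_nonpos_of_nonpos hx.2.2 hy.2.2
  · exact mul_pos_of_neg_of_neg hx.2.1 hy.2.1
  · exact mul_nonneg hx.2.2 hy.2.2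
  · exact mul_pos_of_neg_of_neg hx.2.1 hy.2.1
  · exact mul_nonneg_of_nonpos_of_nonpos hx.2.2 hy.2.2

lemma volume_resonantSet_le_sqrt {L ξ τ M K : ℝ} (hL : 0 < L) (hξ : ξ ≠ 0) :
    volume (resonantSet L ξ τ M K) ≤ ENNReal.ofReal (4 * √(2 * M / (3 * |ξ|))) := by
  refine volume_resonantSet_le (Real.sqrt_nonneg _) fun x hx y hy h1 h2 => ?_
  refine Real.abs_le_sqrt ?_
  refine le_trans ?_ (abs_mul_abs_le_of_phaseSum hL hξ h1 hx.2.2.1 hy.2.2.1)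
  rw [← sq_abs, sq]
  refine mul_le_mul_of_nonneg_left (sq_le_sq.1 ?_) (abs_nonneg _)
  -- `(x + y - ξ)² - (x - y)² = (2x - ξ)(2y - ξ) ≥ 0`.
  nlinarith

lemma volume_resonantSet_le_div {L ξ τ M K : ℝ} (hL : 0 < L) (hξ : ξ ≠ 0) (hM : 0 ≤ M)
    (hK : 0 < K) :
    volume (resonantSet L ξ τ M K) ≤ ENNReal.ofReal (4 * (2 * M / (3 * |ξ|) / K)) := by
  refine volume_resonantSet_le (by positivity) fun x hx y hy h1 h2 => ?_
  rw [le_div_iff₀ hK]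
  refine le_trans ?_ (abs_mul_abs_le_of_phaseSum hL hξ h1 hx.2.2.1 hy.2.2.1)
  refine mul_le_mul_of_nonneg_left ?_ (abs_nonneg _)
  have hx' := hx.2.2.2
  have hy' := hy.2.2.2
  rw [le_abs] at *
  -- `x + y - ξ` is the mean of `2x - ξ` and `2y - ξ`; the mixed cases contradict `h2`, as `K > 0`.
  rcases hx' with h | h <;> rcases hy' with h' | h'
  · left; linarith
  · nlinarith
  · nlinarith
  · right; linarith

/-! ### Dyadic modulation regions and the measure of interaction sets -/

lemma abs_le_bracket (x : ℝ) : |x| ≤ bracket x := Real.abs_le_sqrt (by linarith)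

lemma one_le_bracket (x : ℝ) : 1 ≤ bracket x := by
  rw [bracket, Real.one_le_sqrt]; nlinarith

@[fun_prop]
lemma measurable_bracket : Measurable bracket := by unfold bracket; fun_prop

@[fun_prop]
lemma measurable_modulation (lam : ℝ) : Measurable (modulation lam) := by
  unfold modulation; fun_prop

lemma measurableSet_A (j : ℕ) : MeasurableSet (A j) := by
  have h : Measurable fun p : ℝ × ℝ => bracket p.1 := by fun_prop
  exact (measurableSet_le measurable_const h).inter (measurableSet_lt h measurable_const)

lemma measurableSet_B (lam : ℝ) (k : ℕ) : MeasurableSet (B lam k) := by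
  have h : Measurable fun p : ℝ × ℝ => bracket (modulation lam p) := by fun_prop
  exact (measurableSet_le measurable_const h).inter (measurableSet_lt h measurable_const)

lemma exists_mem_B (lam : ℝ) (p : ℝ × ℝ) : ∃ k, p ∈ B lam k :=
  exists_nat_pow_near (one_le_bracket _) one_lt_two

lemma eq_of_mem_B {lam : ℝ} {p : ℝ × ℝ} {k l : ℕ} (hk : p ∈ B lam k) (hl : p ∈ B lam l) :
    k = l := by
  have h1 := (pow_lt_pow_iff_right₀ (one_lt_two (α := ℝ))).1 (hk.1.trans_lt hl.2)
  have h2 := (pow_lt_pow_iff_right₀ (one_lt_two (α := ℝ))).1 (hl.1.trans_lt hk.2)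
  omega

/-- The pairs of interacting points `(t, p - t)`, parametrised by `t`. -/
def interactionSet (lam : ℝ) (S₁ S₂ : Set (ℝ × ℝ)) (k l : ℕ) (p : ℝ × ℝ) : Set (ℝ × ℝ) :=
  {t | t ∈ B lam k ∩ S₁ ∧ p - t ∈ B lam l ∩ S₂}

lemma measurableSet_interactionSet (lam : ℝ) {S₁ S₂ : Set (ℝ × ℝ)} (h₁ : MeasurableSet S₁)
    (h₂ : MeasurableSet S₂) (k l : ℕ) (p : ℝ × ℝ) :
    MeasurableSet (interactionSet lam S₁ S₂ k l p) :=
  ((measurableSet_B lam k).inter h₁).inter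
    ((measurable_const.sub measurable_id) ((measurableSet_B lam l).inter h₂))

lemma two_pow_min_mul_two_pow_max (k l : ℕ) :
    (2 : ℝ) ^ min k l * 2 ^ max k l = 2 ^ k * 2 ^ l := by
  rw [← pow_add, ← pow_add, min_add_max]

lemma volume_interactionSet_le {lam K d : ℝ} {S₁ S₂ : Set (ℝ × ℝ)} (h₁ : MeasurableSet S₁)
    (h₂ : MeasurableSet S₂) (hS : ∀ p₁ ∈ S₁, ∀ p₂ ∈ S₂, K ≤ |p₁.1 - p₂.1|) (k l : ℕ) (p : ℝ × ℝ)
    (hd : volume (resonantSet (lam ^ 4) p.1 p.2 (4 * 2 ^ max k l) K) ≤ ENNReal.ofReal d) :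
    volume (interactionSet lam S₁ S₂ k l p) ≤ ENNReal.ofReal (4 * 2 ^ min k l * d) := by
  set X := resonantSet (lam ^ 4) p.1 p.2 (4 * 2 ^ max k l) K
  have hk : (2 : ℝ) ^ k ≤ 2 ^ max k l := pow_le_pow_right₀ one_le_two (le_max_left _ _)
  have hl : (2 : ℝ) ^ l ≤ 2 ^ max k l := pow_le_pow_right₀ one_le_two (le_max_right _ _)
  have key : ∀ t ∈ interactionSet lam S₁ S₂ k l p,
      |modulation lam t| ≤ 2 ^ (k + 1) ∧ |modulation lam (p - t)| ≤ 2 ^ (l + 1) := fun t ht =>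
    ⟨(abs_le_bracket _).trans ht.1.1.2.le, (abs_le_bracket _).trans ht.2.1.2.le⟩
  have hfib : ∀ x : ℝ, volume (Prod.mk x ⁻¹' interactionSet lam S₁ S₂ k l p) ≤
      ENNReal.ofReal (4 * 2 ^ min k l) := by
    intro x
    refine volume_le_of_abs_sub_le fun s hs t ht => ?_
    have hs' := key _ hs
    have ht' := key _ ht
    simp only [modulation, Prod.fst_sub, Prod.snd_sub, abs_le] at hs' ht'
    rw [abs_le]
    -- At fixed frequency the modulations of `t` and `p - t` are each `± τ₁` plus a constant, so the
    -- smaller of the two ranges bounds the slice.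
    rcases min_choice k l with h | h <;> rw [h]
    · constructor <;> linarith [pow_succ (2 : ℝ) k]
    · constructor <;> linarith [pow_succ (2 : ℝ) l]
  rw [Measure.volume_eq_prod, Measure.prod_apply (measurableSet_interactionSet lam h₁ h₂ k l p)]
  calc ∫⁻ x, volume (Prod.mk x ⁻¹' interactionSet lam S₁ S₂ k l p)
      ≤ ∫⁻ x, X.indicator (fun _ => ENNReal.ofReal (4 * 2 ^ min k l)) x := by
        refine lintegral_mono_ae ?_
        -- The null set `x ∈ {0, ξ}` is dropped because the phase is singular there.
        filter_upwards [Measure.ae_ne volume 0, Measure.ae_ne volume p.1] with x hx0 hx1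
        by_cases hx : x ∈ X
        · rw [Set.indicator_of_mem hx]; exact hfib x
        · rw [Set.indicator_of_notMem hx, nonpos_iff_eq_zero]
          convert measure_empty (μ := (volume : Measure ℝ))
          refine Set.eq_empty_iff_forall_notMem.2 fun t ht => hx ⟨hx0, ?_, ?_, ?_⟩
          · exact sub_ne_zero.2 hx1.symm
          · have := key _ ht
            simp only [modulation, Prod.fst_sub, Prod.snd_sub, abs_le] at this
            rw [phaseSum, abs_le]
            constructor <;> linarith [pow_succ (2 : ℝ) k, pow_succ (2 : ℝ) l]
          · exact hS _ ht.1.2 _ ht.2.2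
    _ ≤ ENNReal.ofReal (4 * 2 ^ min k l) * volume X := lintegral_indicator_const_le _ _
    _ ≤ ENNReal.ofReal (4 * 2 ^ min k l) * ENNReal.ofReal d := by gcongr
    _ = _ := (ENNReal.ofReal_mul (by positivity)).symm

lemma sqrt_abs_mul_volume_interactionSet_le {lam : ℝ} (hlam : 0 < lam) {S₁ S₂ : Set (ℝ × ℝ)}
    (h₁ : MeasurableSet S₁) (h₂ : MeasurableSet S₂) (k l : ℕ) {p : ℝ × ℝ} (hp : p.1 ≠ 0) :
    ENNReal.ofReal (|p.1| ^ (1 / 2 : ℝ)) * volume (interactionSet lam S₁ S₂ k l p) ≤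
      ENNReal.ofReal (64 * (2 ^ k * 2 ^ l)) := by
  have hp' : 0 < |p.1| := abs_pos.2 hp
  have h := volume_interactionSet_le (K := 0) h₁ h₂ (fun _ _ _ _ => abs_nonneg _) k l p
    (volume_resonantSet_le_sqrt (pow_pos hlam 4) hp)
  refine (mul_le_mul_right h _).trans ?_
  rw [← ENNReal.ofReal_mul (by positivity), ← Real.sqrt_eq_rpow]
  refine ENNReal.ofReal_le_ofReal ?_
  have hm : (1 : ℝ) ≤ 2 ^ max k l := one_le_pow₀ one_le_two
  -- Only `√(2 ^ max k l)` is needed here; the cruder bound gives both estimates the same right-hand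
  -- weight.
  have e : √|p.1| * √(2 * (4 * 2 ^ max k l) / (3 * |p.1|)) ≤ 4 * 2 ^ max k l := by
    rw [← Real.sqrt_mul hp'.le, Real.sqrt_le_left (by positivity)]
    have : |p.1| * (2 * (4 * 2 ^ max k l) / (3 * |p.1|)) = 8 / 3 * 2 ^ max k l := by
      field_simp; ring
    rw [this]; nlinarith
  rw [← two_pow_min_mul_two_pow_max]
  calc _ = 16 * 2 ^ min k l * (√|p.1| * √(2 * (4 * 2 ^ max k l) / (3 * |p.1|))) := by ring
    _ ≤ 16 * 2 ^ min k l * (4 * 2 ^ max k l) := by gcongr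
    _ = _ := by ring

lemma abs_mul_volume_interactionSet_le {lam K : ℝ} (hlam : 0 < lam) (hK : 0 < K)
    {S₁ S₂ : Set (ℝ × ℝ)} (h₁ : MeasurableSet S₁) (h₂ : MeasurableSet S₂)
    (hS : ∀ p₁ ∈ S₁, ∀ p₂ ∈ S₂, K ≤ |p₁.1 - p₂.1|) (k l : ℕ) {p : ℝ × ℝ} (hp : p.1 ≠ 0) :
    ENNReal.ofReal |p.1| * volume (interactionSet lam S₁ S₂ k l p) ≤
      ENNReal.ofReal (64 * (2 ^ k * 2 ^ l) / K) := by
  have hp' : 0 < |p.1| := abs_pos.2 hp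
  have h := volume_interactionSet_le h₁ h₂ hS k l p
    (volume_resonantSet_le_div (pow_pos hlam 4) hp (by positivity) hK)
  refine (mul_le_mul_right h _).trans ?_
  rw [← ENNReal.ofReal_mul (by positivity)]
  refine ENNReal.ofReal_le_ofReal ?_
  rw [← two_pow_min_mul_two_pow_max]
  have : |p.1| * (4 * 2 ^ min k l * (4 * (2 * (4 * 2 ^ max k l) / (3 * |p.1|) / K))) =
      128 / 3 * (2 ^ min k l * 2 ^ max k l) / K := by field_simp; ring
  rw [this]
  gcongr
  norm_num

/-! ### Minkowski, Cauchy–Schwarz and convolution of nonnegative functions -/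

lemma eLpNorm_two_eq {α : Type*} [MeasurableSpace α] (μ : Measure α) (f : α → ℝ≥0∞) :
    eLpNorm f 2 μ = (∫⁻ x, f x ^ (2 : ℝ) ∂μ) ^ (1 / 2 : ℝ) := by
  simp [eLpNorm_eq_lintegral_rpow_enorm_toReal (p := 2) two_ne_zero ENNReal.ofNat_ne_top]

lemma eLpNorm_two_le_iff {α : Type*} [MeasurableSpace α] (μ : Measure α) (f : α → ℝ≥0∞)
    (c : ℝ≥0∞) : eLpNorm f 2 μ ≤ c ↔ ∫⁻ x, f x ^ (2 : ℝ) ∂μ ≤ c ^ (2 : ℝ) := by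
  rw [eLpNorm_two_eq, one_div, ENNReal.rpow_inv_le_iff two_pos]

/-- Countable Minkowski: monotone convergence along the finite partial sums. -/
lemma eLpNorm_two_tsum_le {α ι : Type*} [MeasurableSpace α] [Countable ι] {μ : Measure α}
    {f : ι → α → ℝ≥0∞} (hf : ∀ i, Measurable (f i)) :
    eLpNorm (fun x => ∑' i, f i x) 2 μ ≤ ∑' i, eLpNorm (f i) 2 μ := by
  rw [eLpNorm_two_le_iff]
  have h : ∀ x, (∑' i, f i x) ^ (2 : ℝ) = ⨆ s : Finset ι, (∑ i ∈ s, f i x) ^ (2 : ℝ) := fun x => by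
    rw [ENNReal.tsum_eq_iSup_sum]
    exact (ENNReal.orderIsoRpow 2 two_pos).map_iSup _
  simp_rw [h]
  rw [lintegral_iSup_directed]
  · refine iSup_le fun s => ?_
    have := (eLpNorm_sum_le (μ := μ) (p := 2) (s := s)
      (fun i _ => (hf i).aestronglyMeasurable) (by norm_num)).trans
      (ENNReal.sum_le_tsum s)
    rw [eLpNorm_two_le_iff] at this
    simpa using this
  · exact fun s => ((Finset.measurable_sum s fun i _ => hf i).pow_const _).aemeasurable
  · refine Monotone.directed_le fun s t hst x => ?_
    dsimp only
    gcongr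

/-- Cauchy–Schwarz against the indicator of `E`. -/
lemma lintegral_mul_rpow_two_le {α : Type*} [MeasurableSpace α] {μ : Measure α} {f : α → ℝ≥0∞}
    (hf : Measurable f) {E : Set α} (hE : MeasurableSet E) (h : ∀ x ∉ E, f x = 0) :
    (∫⁻ x, f x ∂μ) ^ (2 : ℝ) ≤ μ E * ∫⁻ x, f x ^ (2 : ℝ) ∂μ := by
  have h1 : ∫⁻ x, f x ∂μ = ∫⁻ x, (E.indicator (1 : α → ℝ≥0∞) * f) x ∂μ := by
    refine lintegral_congr fun x => ?_
    by_cases hx : x ∈ E <;> simp [hx, h]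
  have hm : Measurable (E.indicator (1 : α → ℝ≥0∞)) := measurable_one.indicator hE
  have h2 := ENNReal.lintegral_mul_le_Lp_mul_Lq μ Real.HolderConjugate.two_two
    hm.aemeasurable hf.aemeasurable
  have h3 : ∫⁻ x, E.indicator (1 : α → ℝ≥0∞) x ^ (2 : ℝ) ∂μ = μ E := by
    rw [← lintegral_indicator_one hE]
    refine lintegral_congr fun x => ?_
    by_cases hx : x ∈ E <;> simp [hx]
  rw [h1]
  refine (ENNReal.rpow_le_rpow h2 two_pos.le).trans_eq ?_
  rw [h3, ENNReal.mul_rpow_of_nonneg _ _ two_pos.le, ← ENNReal.rpow_mul, ← ENNReal.rpow_mul]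
  norm_num

/-- The convolution of nonnegative functions on the frequency plane. -/
def lconv (Φ Ψ : ℝ × ℝ → ℝ≥0∞) (p : ℝ × ℝ) : ℝ≥0∞ := ∫⁻ t, Φ t * Ψ (p - t)

lemma measurable_lconv {Φ Ψ : ℝ × ℝ → ℝ≥0∞} (hΦ : Measurable Φ) (hΨ : Measurable Ψ) :
    Measurable (lconv Φ Ψ) :=
  Measurable.lintegral_prod_right'
    (f := fun q : (ℝ × ℝ) × (ℝ × ℝ) => Φ q.2 * Ψ (q.1 - q.2)) (by fun_prop)

lemma lintegral_lconv {Φ Ψ : ℝ × ℝ → ℝ≥0∞} (hΦ : Measurable Φ) (hΨ : Measurable Ψ) :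
    ∫⁻ p, lconv Φ Ψ p = (∫⁻ t, Φ t) * ∫⁻ t, Ψ t := by
  unfold lconv
  rw [lintegral_lintegral_swap (by fun_prop)]
  have : ∀ t, ∫⁻ p, Φ t * Ψ (p - t) = Φ t * ∫⁻ p, Ψ p := fun t => by
    rw [lintegral_const_mul _ (by fun_prop), lintegral_sub_right_eq_self]
  simp_rw [this]
  rw [lintegral_mul_const _ hΦ]

lemma lconv_tsum {Φ Ψ : ℕ → ℝ × ℝ → ℝ≥0∞} (hΦ : ∀ k, Measurable (Φ k))
    (hΨ : ∀ k, Measurable (Ψ k)) (p : ℝ × ℝ) :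
    lconv (fun t => ∑' k, Φ k t) (fun t => ∑' l, Ψ l t) p =
      ∑' q : ℕ × ℕ, lconv (Φ q.1) (Ψ q.2) p := by
  unfold lconv
  have hm : ∀ q : ℕ × ℕ, AEMeasurable (fun t => Φ q.1 t * Ψ q.2 (p - t)) := fun q =>
    ((hΦ q.1).mul ((hΨ q.2).comp (measurable_const.sub measurable_id))).aemeasurable
  rw [← lintegral_tsum hm]
  refine lintegral_congr fun t => ?_
  rw [ENNReal.tsum_prod (f := fun k l => Φ k t * Ψ l (p - t))]
  simp_rw [ENNReal.tsum_mul_left, ENNReal.tsum_mul_right]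

lemma tsum_indicator_B (lam : ℝ) (S : Set (ℝ × ℝ)) {Φ : ℝ × ℝ → ℝ≥0∞} (h : ∀ t ∉ S, Φ t = 0)
    (t : ℝ × ℝ) : ∑' k, (B lam k ∩ S).indicator Φ t = Φ t := by
  obtain ⟨k, hk⟩ := exists_mem_B lam t
  rw [tsum_eq_single k]
  · by_cases ht : t ∈ S <;> simp [hk, ht, h]
  · intro l hl
    exact Set.indicator_of_notMem (fun h' => hl (eq_of_mem_B h'.1 hk)) _

/-! ### The bilinear estimate for nonnegative functions -/

/-- Cauchy–Schwarz at each `p` leaves the convolution of the squares, whose integral factors by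
Tonelli. -/
lemma eLpNorm_mul_lconv_indicator_le {lam : ℝ} {S₁ S₂ : Set (ℝ × ℝ)} (h₁ : MeasurableSet S₁)
    (h₂ : MeasurableSet S₂) {Φ Ψ : ℝ × ℝ → ℝ≥0∞} (hΦ : Measurable Φ) (hΨ : Measurable Ψ)
    {w : ℝ × ℝ → ℝ≥0∞} {c : ℝ≥0∞} {k l : ℕ}
    (hc : ∀ᵐ p, w p ^ (2 : ℝ) * volume (interactionSet lam S₁ S₂ k l p) ≤ c ^ (2 : ℝ)) :
    eLpNorm (fun p => w p * lconv ((B lam k ∩ S₁).indicator Φ) ((B lam l ∩ S₂).indicator Ψ) p) 2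
      volume ≤ c * (eLpNorm ((B lam k ∩ S₁).indicator Φ) 2 volume *
        eLpNorm ((B lam l ∩ S₂).indicator Ψ) 2 volume) := by
  set Φ' := (B lam k ∩ S₁).indicator Φ with hΦ'
  set Ψ' := (B lam l ∩ S₂).indicator Ψ with hΨ'
  have mΦ : Measurable Φ' := hΦ.indicator ((measurableSet_B lam k).inter h₁)
  have mΨ : Measurable Ψ' := hΨ.indicator ((measurableSet_B lam l).inter h₂)
  rw [eLpNorm_two_le_iff]
  simp_rw [eLpNorm_two_eq, ENNReal.mul_rpow_of_nonneg _ _ (two_pos (α := ℝ)).le,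
    ← ENNReal.rpow_mul]
  norm_num only [ENNReal.rpow_one]
  rw [← lintegral_lconv (mΦ.pow_const _) (mΨ.pow_const _),
    ← lintegral_const_mul _ (measurable_lconv (mΦ.pow_const _) (mΨ.pow_const _))]
  refine lintegral_mono_ae (hc.mono fun p hp => ?_)
  have h := lintegral_mul_rpow_two_le (μ := volume) (f := fun t => Φ' t * Ψ' (p - t)) (by fun_prop)
    (measurableSet_interactionSet lam h₁ h₂ k l p) (fun t ht => by
      by_cases ht' : t ∈ B lam k ∩ S₁
      · have : p - t ∉ B lam l ∩ S₂ := fun h' => ht ⟨ht', h'⟩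
        rw [hΨ', Set.indicator_of_notMem this, mul_zero]
      · rw [hΦ', Set.indicator_of_notMem ht', zero_mul])
  simp_rw [ENNReal.mul_rpow_of_nonneg _ _ (two_pos (α := ℝ)).le] at h
  calc _ ≤ w p ^ (2 : ℝ) * (volume (interactionSet lam S₁ S₂ k l p) * _) := by
        gcongr; exact h
    _ = (w p ^ (2 : ℝ) * volume (interactionSet lam S₁ S₂ k l p)) * _ := (mul_assoc _ _ _).symm
    _ ≤ _ := by gcongr; exact le_rfl

lemma eLpNorm_mul_lconv_tsum_le {Φ Ψ : ℕ → ℝ × ℝ → ℝ≥0∞} (hΦ : ∀ k, Measurable (Φ k))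
    (hΨ : ∀ k, Measurable (Ψ k)) {w : ℝ × ℝ → ℝ≥0∞} (hw : Measurable w) {c : ℝ≥0∞}
    {a b : ℕ → ℝ≥0∞}
    (h : ∀ k l, eLpNorm (fun p => w p * lconv (Φ k) (Ψ l) p) 2 volume ≤ c * (a k * b l)) :
    eLpNorm (fun p => w p * lconv (fun t => ∑' k, Φ k t) (fun t => ∑' l, Ψ l t) p) 2 volume ≤
      c * (∑' k, a k) * ∑' l, b l := by
  have hm : ∀ q : ℕ × ℕ, Measurable fun p => w p * lconv (Φ q.1) (Ψ q.2) p := fun q =>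
    hw.mul (measurable_lconv (hΦ q.1) (hΨ q.2))
  simp_rw [lconv_tsum hΦ hΨ, ← ENNReal.tsum_mul_left (a := w _)]
  refine (eLpNorm_two_tsum_le hm).trans ?_
  have h' : ∀ q : ℕ × ℕ, eLpNorm (fun p => w p * lconv (Φ q.1) (Ψ q.2) p) 2 volume ≤
      c * (a q.1 * b q.2) := fun q => h q.1 q.2
  refine (ENNReal.tsum_le_tsum h').trans_eq ?_
  rw [ENNReal.tsum_prod (f := fun k l => c * (a k * b l))]
  simp_rw [ENNReal.tsum_mul_left, ENNReal.tsum_mul_right]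
  rw [mul_assoc]

/-- The modulation part of the norm, for functions concentrated on `S`. -/
def modulationNorm (lam : ℝ) (S : Set (ℝ × ℝ)) (Φ : ℝ × ℝ → ℝ≥0∞) : ℝ≥0∞ :=
  ∑' k : ℕ, ENNReal.ofReal (√(2 ^ k)) * eLpNorm ((B lam k ∩ S).indicator Φ) 2 volume

lemma eLpNorm_mul_lconv_le {lam : ℝ} {S₁ S₂ : Set (ℝ × ℝ)} (h₁ : MeasurableSet S₁)
    (h₂ : MeasurableSet S₂) {Φ Ψ : ℝ × ℝ → ℝ≥0∞} (hΦ : Measurable Φ) (hΨ : Measurable Ψ)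
    (hΦS : ∀ t ∉ S₁, Φ t = 0) (hΨS : ∀ t ∉ S₂, Ψ t = 0)
    {w : ℝ × ℝ → ℝ≥0∞} (hw : Measurable w) {c : ℝ≥0∞}
    (hc : ∀ k l : ℕ, ∀ᵐ p, w p ^ (2 : ℝ) * volume (interactionSet lam S₁ S₂ k l p) ≤
      (c * (ENNReal.ofReal (√(2 ^ k)) * ENNReal.ofReal (√(2 ^ l)))) ^ (2 : ℝ)) :
    eLpNorm (fun p => w p * lconv Φ Ψ p) 2 volume ≤
      c * modulationNorm lam S₁ Φ * modulationNorm lam S₂ Ψ := by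
  have key := eLpNorm_mul_lconv_tsum_le (Φ := fun k => (B lam k ∩ S₁).indicator Φ)
    (Ψ := fun k => (B lam k ∩ S₂).indicator Ψ)
    (fun k => hΦ.indicator ((measurableSet_B lam k).inter h₁))
    (fun k => hΨ.indicator ((measurableSet_B lam k).inter h₂)) hw (c := c)
    (a := fun k => ENNReal.ofReal (√(2 ^ k)) * eLpNorm ((B lam k ∩ S₁).indicator Φ) 2 volume)
    (b := fun k => ENNReal.ofReal (√(2 ^ k)) * eLpNorm ((B lam k ∩ S₂).indicator Ψ) 2 volume)
    fun k l => (eLpNorm_mul_lconv_indicator_le h₁ h₂ hΦ hΨ (hc k l)).trans_eq (by ring)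
  have e₁ : (fun t => ∑' k, (B lam k ∩ S₁).indicator Φ t) = Φ :=
    funext fun t => tsum_indicator_B lam S₁ hΦS t
  have e₂ : (fun t => ∑' k, (B lam k ∩ S₂).indicator Ψ t) = Ψ :=
    funext fun t => tsum_indicator_B lam S₂ hΨS t
  rw [e₁, e₂] at key
  exact key

/-- This puts both factors in L², whence the convolution converges at every point. -/
lemma eLpNorm_le_modulationNorm (lam : ℝ) {S : Set (ℝ × ℝ)} (hS : MeasurableSet S)
    {Φ : ℝ × ℝ → ℝ≥0∞} (hΦ : Measurable Φ) (h : ∀ t ∉ S, Φ t = 0) :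
    eLpNorm Φ 2 volume ≤ modulationNorm lam S Φ := by
  have e : Φ = fun t => ∑' k, (B lam k ∩ S).indicator Φ t :=
    funext fun t => (tsum_indicator_B lam S h t).symm
  calc eLpNorm Φ 2 volume = eLpNorm (fun t => ∑' k, (B lam k ∩ S).indicator Φ t) 2 volume := by
        rw [← e]
    _ ≤ ∑' k, eLpNorm ((B lam k ∩ S).indicator Φ) 2 volume :=
        eLpNorm_two_tsum_le fun k => hΦ.indicator ((measurableSet_B lam k).inter hS)
    _ ≤ _ := ENNReal.tsum_le_tsum fun k => by
        refine le_mul_of_one_le_left' ?_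
        rw [ENNReal.one_le_ofReal, Real.one_le_sqrt]
        exact one_le_pow₀ one_le_two

/-! ### Distributions and the functions representing them -/

lemma exists_schwartzMap_eq {φ : ℝ × ℝ → ℝ} (hφ : ContDiff ℝ (⊤ : ℕ∞) φ)
    (hc : HasCompactSupport φ) : ∃ u : 𝓢(ℝ × ℝ, ℂ), ∀ p, u p = φ p := by
  have hc' : HasCompactSupport fun p => (φ p : ℂ) :=
    hc.comp_left (g := Complex.ofReal) Complex.ofReal_zero
  exact ⟨hc'.toSchwartzMap (Complex.ofRealCLM.contDiff.comp hφ), fun p => rfl⟩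

lemma IsGivenBy.exists_integral_smul {f : 𝓢'(ℝ × ℝ, ℂ)} {φ : ℝ × ℝ → ℝ}
    (hφ : ContDiff ℝ (⊤ : ℕ∞) φ) (hc : HasCompactSupport φ) :
    ∃ u : 𝓢(ℝ × ℝ, ℂ), tsupport u ⊆ tsupport φ ∧
      ∀ F : ℝ × ℝ → ℂ, IsGivenBy f F → ∫ p, φ p • F p = f u := by
  obtain ⟨u, hu⟩ := exists_schwartzMap_eq hφ hc
  have hs : Function.support u ⊆ Function.support φ := fun p hp hp' => hp (by simp [hu, hp'])
  refine ⟨u, closure_mono hs, fun F h => ?_⟩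
  rw [h.2 u (hc.mono hs)]
  simp_rw [hu, Complex.real_smul]

lemma IsGivenBy.ae_eq {f : 𝓢'(ℝ × ℝ, ℂ)} {F F' : ℝ × ℝ → ℂ} (h : IsGivenBy f F)
    (h' : IsGivenBy f F') : F =ᵐ[volume] F' := by
  refine ae_eq_of_integral_contDiff_smul_eq h.1 h'.1 fun φ hφ hc => ?_
  obtain ⟨u, -, e⟩ := IsGivenBy.exists_integral_smul (f := f) hφ hc
  rw [e F h, e F' h']

/-- Near a point off the support `f` kills all test functions, so `F` vanishes a.e. there; local
nullity then gives global nullity. -/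
lemma IsGivenBy.ae_eq_zero {f : 𝓢'(ℝ × ℝ, ℂ)} {F : ℝ × ℝ → ℂ} (h : IsGivenBy f F) :
    ∀ᵐ p, p ∉ Distribution.dsupport f → F p = 0 := by
  rw [ae_iff]
  refine measure_null_of_locally_null _ fun p hp => ?_
  simp only [Set.mem_ofPred_eq, Classical.not_imp] at hp
  obtain ⟨s, hs, hso, hps⟩ := (Distribution.notMem_dsupport_iff p).1 hp.1
  have h0 : ∀ᵐ x, x ∈ s → F x = 0 := by
    refine hso.ae_eq_zero_of_integral_contDiff_smul_eq_zero (h.1.locallyIntegrableOn s)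
      fun φ hφ hc hφs => ?_
    obtain ⟨u, hu, e⟩ := IsGivenBy.exists_integral_smul (f := f) hφ hc
    rw [e F h]
    exact hs u (hu.trans hφs)
  refine ⟨s ∩ {x | ¬(x ∉ Distribution.dsupport f → F x = 0)},
    Filter.inter_mem (mem_nhdsWithin_of_mem_nhds (hso.mem_nhds hps)) self_mem_nhdsWithin, measure_mono_null ?_ (ae_iff.1 h0)⟩
  exact fun x hx hx' => hx.2 fun _ => hx' hx.1

lemma isClosed_dsupport (f : 𝓢'(ℝ × ℝ, ℂ)) : IsClosed (Distribution.dsupport f) :=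
  isClosed_sInter fun _ h => h.2

lemma modulationNorm_le_hatNormFun {lam : ℝ} {j : ℕ} {S : Set (ℝ × ℝ)} (hSA : S ⊆ A j)
    {Φ : ℝ × ℝ → ℝ≥0∞} {F : ℝ × ℝ → ℂ} (hS : MeasurableSet S)
    (hF : (fun p => ‖F p‖ₑ) =ᵐ[volume] Φ) :
    modulationNorm lam S Φ ≤ hatNormFun lam 0 (1 / 2) F := by
  have h : modulationNorm lam S Φ ≤ ∑' k : ℕ,
      eLpNorm (fun p => ((bracket p.1 ^ (0 : ℝ) * bracket (modulation lam p) ^ (1 / 2 : ℝ) : ℝ) : ℂ)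
        * F p) 2 (volume.restrict (A j ∩ B lam k)) := by
    refine ENNReal.tsum_le_tsum fun k => ?_
    rw [eLpNorm_indicator_eq_eLpNorm_restrict ((measurableSet_B lam k).inter hS)]
    calc _ ≤ ENNReal.ofReal (√(2 ^ k)) * eLpNorm Φ 2 (volume.restrict (A j ∩ B lam k)) := by
          have hsub : B lam k ∩ S ⊆ A j ∩ B lam k := fun p hp => ⟨hSA hp.2, hp.1⟩
          gcongr
      _ = ENNReal.ofReal (√(2 ^ k)) * eLpNorm F 2 (volume.restrict (A j ∩ B lam k)) := by
          congr 1
          refine (eLpNorm_congr_enorm_ae ?_).symm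
          filter_upwards [ae_restrict_of_ae hF] with p hp
          simpa using hp
      _ = eLpNorm (√(2 ^ k) • F) 2 (volume.restrict (A j ∩ B lam k)) := by
          rw [eLpNorm_const_smul, Real.enorm_of_nonneg (Real.sqrt_nonneg _)]
      _ ≤ _ := by
          refine eLpNorm_mono_ae ?_
          filter_upwards [ae_restrict_mem ((measurableSet_A j).inter (measurableSet_B lam k))]
            with p hp
          have h1 : √(2 ^ k) ≤ √(bracket (modulation lam p)) := Real.sqrt_le_sqrt hp.2.1
          rw [Pi.smul_apply, norm_smul, norm_mul, Complex.norm_real, Real.rpow_zero, one_mul,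
            ← Real.sqrt_eq_rpow, Real.norm_of_nonneg (Real.sqrt_nonneg _),
            Real.norm_of_nonneg (Real.sqrt_nonneg _)]
          gcongr
  -- The support lies in `A j`, so one term of the ℓ² sum over annuli suffices.
  refine h.trans ?_
  rw [hatNormFun, one_div (2 : ℝ), ENNReal.le_rpow_inv_iff two_pos]
  exact ENNReal.le_tsum (f := fun j => (∑' k : ℕ,
      eLpNorm (fun p => ((bracket p.1 ^ (0 : ℝ) * bracket (modulation lam p) ^ (2 : ℝ)⁻¹ : ℝ) : ℂ)
        * F p) 2 (volume.restrict (A j ∩ B lam k))) ^ (2 : ℝ)) j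

/-- A locally integrable function representing `f` has a measurable modulus vanishing off the
support of `f`, with controlled norm. -/
lemma IsGivenBy.exists_measurable {f : 𝓢'(ℝ × ℝ, ℂ)} {F : ℝ × ℝ → ℂ} (h : IsGivenBy f F)
    (lam : ℝ) {j : ℕ} (hj : Distribution.dsupport f ⊆ A j) :
    ∃ Φ : ℝ × ℝ → ℝ≥0∞, Measurable Φ ∧ (fun p => ‖F p‖ₑ) =ᵐ[volume] Φ ∧
      (∀ t ∉ Distribution.dsupport f, Φ t = 0) ∧
      modulationNorm lam (Distribution.dsupport f) Φ ≤ hatNorm lam 0 (1 / 2) f := by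
  have hm := (isClosed_dsupport f).measurableSet
  have hF := h.1.aestronglyMeasurable.enorm
  have e : (fun p => ‖F p‖ₑ) =ᵐ[volume] (Distribution.dsupport f).indicator (hF.mk _) := by
    filter_upwards [hF.ae_eq_mk, h.ae_eq_zero] with p hp hp0
    by_cases hp' : p ∈ Distribution.dsupport f
    · rw [Set.indicator_of_mem hp', hp]
    · rw [Set.indicator_of_notMem hp', hp0 hp', enorm_zero]
  refine ⟨_, hF.measurable_mk.indicator hm, e, fun t ht => Set.indicator_of_notMem ht _, ?_⟩
  -- `hatNorm` is an infimum over representatives, but these all agree a.e.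
  refine le_iInf₂ fun F' hF' => modulationNorm_le_hatNormFun hj hm ?_
  filter_upwards [e, h.ae_eq hF'] with p hp hp'
  rw [← hp', hp]

/-! ### Transfer to complex convolutions and conclusion -/

lemma weightedL2_conv_le {F G : ℝ × ℝ → ℂ} {Φ Ψ : ℝ × ℝ → ℝ≥0∞}
    (hF : (fun p => ‖F p‖ₑ) =ᵐ[volume] Φ) (hG : (fun p => ‖G p‖ₑ) =ᵐ[volume] Ψ) (a : ℝ) :
    weightedL2 a (conv F G) ≤
      eLpNorm (fun p : ℝ × ℝ => ENNReal.ofReal (|p.1| ^ a) * lconv Φ Ψ p) 2 volume := by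
  refine eLpNorm_mono_enorm fun p => ?_
  rw [enorm_mul, enorm_eq_self]
  have h1 : ‖((|p.1| ^ a : ℝ) : ℂ)‖ₑ = ENNReal.ofReal (|p.1| ^ a) := by
    rw [← ofReal_norm, Complex.norm_real, Real.norm_of_nonneg (by positivity)]
  rw [h1]
  gcongr
  refine (enorm_integral_le_lintegral_enorm _).trans_eq (lintegral_congr_ae ?_)
  have hG' := (Measure.measurePreserving_sub_left volume p).quasiMeasurePreserving.ae_eq_comp hG
  filter_upwards [hF, hG'] with t ht ht'
  simp only [Function.comp_apply] at ht'
  simp [ht, ht']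

lemma convolutionExists_of_memLp {F G : ℝ × ℝ → ℂ} (hF : MemLp F 2 volume)
    (hG : MemLp G 2 volume) :
    ConvolutionExists F G (ContinuousLinearMap.mul ℂ ℂ) volume := fun p =>
  hF.integrable_mul (hG.comp_measurePreserving (Measure.measurePreserving_sub_left volume p))

lemma IsGivenBy.memLp {f : 𝓢'(ℝ × ℝ, ℂ)} {F : ℝ × ℝ → ℂ} (h : IsGivenBy f F)
    {lam : ℝ} {j : ℕ} (hj : Distribution.dsupport f ⊆ A j)
    (hf : hatNorm lam 0 (1 / 2) f ≠ ∞) : MemLp F 2 volume := by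
  obtain ⟨Φ, mΦ, eΦ, zΦ, nΦ⟩ := h.exists_measurable lam hj
  refine ⟨h.1.aestronglyMeasurable, ?_⟩
  have e : eLpNorm F 2 volume = eLpNorm Φ 2 volume :=
    eLpNorm_congr_enorm_ae (eΦ.mono fun p hp => by simpa using hp)
  rw [e]
  exact ((eLpNorm_le_modulationNorm lam (isClosed_dsupport f).measurableSet mΦ zΦ).trans
    nΦ).trans_lt hf.lt_top

lemma weightedL2_conv_le_hatNorm {lam : ℝ} {j₁ j₂ : ℕ} {f g : 𝓢'(ℝ × ℝ, ℂ)}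
    (hf : Distribution.dsupport f ⊆ A j₁) (hg : Distribution.dsupport g ⊆ A j₂)
    {F G : ℝ × ℝ → ℂ} (hF : IsGivenBy f F) (hG : IsGivenBy g G) {a : ℝ} {c : ℝ≥0∞}
    (hc : ∀ k l : ℕ, ∀ p : ℝ × ℝ, p.1 ≠ 0 → ENNReal.ofReal (|p.1| ^ (a * 2)) *
      volume (interactionSet lam (Distribution.dsupport f) (Distribution.dsupport g) k l p) ≤
      c ^ (2 : ℝ) * ENNReal.ofReal (2 ^ k * 2 ^ l)) :
    weightedL2 a (conv F G) ≤ c * hatNorm lam 0 (1 / 2) f * hatNorm lam 0 (1 / 2) g := by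
  obtain ⟨Φ, mΦ, eΦ, zΦ, nΦ⟩ := hF.exists_measurable lam hf
  obtain ⟨Ψ, mΨ, eΨ, zΨ, nΨ⟩ := hG.exists_measurable lam hg
  have hne : ∀ᵐ p : ℝ × ℝ, p.1 ≠ 0 :=
    Measure.quasiMeasurePreserving_fst.ae (Measure.ae_ne volume (0 : ℝ))
  have hw : Measurable fun p : ℝ × ℝ => ENNReal.ofReal (|p.1| ^ a) := by fun_prop
  refine (weightedL2_conv_le eΦ eΨ a).trans ((eLpNorm_mul_lconv_le
    (isClosed_dsupport f).measurableSet (isClosed_dsupport g).measurableSet mΦ mΨ zΦ zΨ hw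
    (lam := lam) (c := c) fun k l => ?_).trans (by gcongr))
  filter_upwards [hne] with p hp
  refine le_of_eq_of_le ?_ ((hc k l p hp).trans_eq ?_)
  · rw [ENNReal.ofReal_rpow_of_nonneg (by positivity) two_pos.le, ← Real.rpow_mul (abs_nonneg _)]
  · rw [← ENNReal.ofReal_mul (Real.sqrt_nonneg _), ENNReal.mul_rpow_of_nonneg _ _ two_pos.le,
      ← Real.sqrt_mul (by positivity), ENNReal.ofReal_rpow_of_nonneg (by positivity) two_pos.le,
      Real.rpow_two, Real.sq_sqrt (by positivity)]

lemma abs_mul_volume_interactionSet_le_freqSep {lam : ℝ} (hlam : 0 < lam) (f g : 𝓢'(ℝ × ℝ, ℂ))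
    (k l : ℕ) {p : ℝ × ℝ} (hp : p.1 ≠ 0) :
    ENNReal.ofReal |p.1| *
      volume (interactionSet lam (Distribution.dsupport f) (Distribution.dsupport g) k l p) ≤
      (8 * freqSep f g ^ (-1 / 2 : ℝ)) ^ (2 : ℝ) * ENNReal.ofReal (2 ^ k * 2 ^ l) := by
  have hK : ∀ p₁ ∈ Distribution.dsupport f, ∀ p₂ ∈ Distribution.dsupport g,
      freqSep f g ≤ ENNReal.ofReal |p₁.1 - p₂.1| := fun p₁ h₁ p₂ h₂ =>
    iInf₂_le_of_le p₁ h₁ (iInf₂_le p₂ h₂)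
  have hpow : (8 * freqSep f g ^ (-1 / 2 : ℝ)) ^ (2 : ℝ) = 64 * (freqSep f g)⁻¹ := by
    rw [ENNReal.mul_rpow_of_nonneg _ _ two_pos.le, ← ENNReal.rpow_mul, ← ENNReal.rpow_neg_one]
    norm_num
  rw [hpow]
  rcases eq_or_ne (freqSep f g) ∞ with htop | htop
  · have : interactionSet lam (Distribution.dsupport f) (Distribution.dsupport g) k l p = ∅ := by
      refine Set.eq_empty_iff_forall_notMem.2 fun t ht => ?_
      have := hK _ ht.1.2 _ ht.2.2
      simp [htop] at this
    simp [this]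
  -- If `K = 0` the right-hand side is `∞`.
  rcases eq_or_ne (freqSep f g) 0 with h0 | h0
  · simp [h0, ENNReal.mul_top]
  have hpos := ENNReal.toReal_pos h0 htop
  refine (abs_mul_volume_interactionSet_le hlam hpos (isClosed_dsupport f).measurableSet
    (isClosed_dsupport g).measurableSet (fun p₁ h₁ p₂ h₂ => ENNReal.toReal_le_of_le_ofReal
      (abs_nonneg _) (hK p₁ h₁ p₂ h₂)) k l hp).trans_eq ?_
  rw [← ENNReal.ofReal_toReal htop, ← ENNReal.ofReal_inv_of_pos hpos,
    ENNReal.toReal_ofReal hpos.le, div_eq_mul_inv,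
    show (64 : ℝ≥0∞) = ENNReal.ofReal 64 by simp, ← ENNReal.ofReal_mul (by norm_num),
    ← ENNReal.ofReal_mul (by positivity)]
  congr 1
  ring

end Ostrovsky

end

theorem lemma2p1 :
    ∃ C : ℝ≥0, 0 < C ∧
      ∀ lam : ℝ, 1 ≤ lam →
      ∀ (j₁ j₂ : ℕ) (f g : 𝓢'(ℝ × ℝ, ℂ)),
        Distribution.dsupport f ⊆ Ostrovsky.A j₁ →
        Distribution.dsupport g ⊆ Ostrovsky.A j₂ →
        (∀ p₁ ∈ Distribution.dsupport f, ∀ p₂ ∈ Distribution.dsupport g,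
          Ostrovsky.Admissible lam p₁.1 p₂.1) →
        ∀ F G : ℝ × ℝ → ℂ, Ostrovsky.IsGivenBy f F → Ostrovsky.IsGivenBy g G →
          (Ostrovsky.hatNorm lam 0 (1 / 2) f ≠ ∞ → Ostrovsky.hatNorm lam 0 (1 / 2) g ≠ ∞ →
            ConvolutionExists F G (ContinuousLinearMap.mul ℂ ℂ) volume) ∧
          Ostrovsky.weightedL2 (1 / 4) (Ostrovsky.conv F G) ≤
            C * Ostrovsky.hatNorm lam 0 (1 / 2) f * Ostrovsky.hatNorm lam 0 (1 / 2) g ∧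
          Ostrovsky.weightedL2 (1 / 2) (Ostrovsky.conv F G) ≤
            C * Ostrovsky.freqSep f g ^ (-1 / 2 : ℝ) *
              Ostrovsky.hatNorm lam 0 (1 / 2) f * Ostrovsky.hatNorm lam 0 (1 / 2) g := by
  -- `8 = √64`, with 64 the constant in the measure bounds.
  refine ⟨8, by norm_num, fun lam hlam j₁ j₂ f g hf hg _ F G hF hG => ⟨fun hf' hg' => ?_, ?_, ?_⟩⟩
  · exact Ostrovsky.convolutionExists_of_memLp (hF.memLp hf hf') (hG.memLp hg hg')
  · refine Ostrovsky.weightedL2_conv_le_hatNorm hf hg hF hG fun k l p hp => ?_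
    have h := Ostrovsky.sqrt_abs_mul_volume_interactionSet_le (zero_lt_one.trans_le hlam)
      (Ostrovsky.isClosed_dsupport f).measurableSet (Ostrovsky.isClosed_dsupport g).measurableSet
      k l hp
    rw [ENNReal.ofReal_mul (by norm_num)] at h
    convert h using 2 <;> norm_num
  · refine Ostrovsky.weightedL2_conv_le_hatNorm hf hg hF hG fun k l p hp => ?_
    have h := Ostrovsky.abs_mul_volume_interactionSet_le_freqSep (zero_lt_one.trans_le hlam) f g
      k l hp
    convert h using 2
    · norm_num
    · rfl
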